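/- Let $G$ be a finite abelian group. For $g\in G$ let $$\tau_g\colon H^{4}(G;\mathbb{Q}/\mathbb{Z})\longrightarrow H^{3}(G;\mathbb{Q}/\mathbb{Z})$$ be the transgression map (group cohomology with trivial coefficients $\mathbb{Q}/\mathbb{Z}$), which sends the class of an inhomogeneous $4$-cocycle $\pi\colon G^4\to\mathbb{Q}/\mathbb{Z}$ to the class of the $3$-cocycle $$(\tau_g\pi)(h,k,l)=\pi(g,h,k,l)-\pi(h,g,k,l)+\pi(h,k,g,l)-\pi(h,k,l,g).$$ Then the only class in $H^4(G;\mathbb{Q}/\mathbb{Z})$ all of whose transgressions vanish is the zero class: for $c\in H^4(G;\mathbb{Q}/\mathbb{Z})$, one has $\tau_g(c)=0$ for all $g\in G$ if and only if $c=0$. -/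

import Mathlib

open CategoryTheory

namespace Transgression

/-- Transgression (slant product) of inhomogeneous cochains with respect to `g`:
`(τ_g f)(h₁, …, hₙ) = ∑_{i = 0}^{n} (-1)^i f(h₁, …, hᵢ, g, hᵢ₊₁, …, hₙ)`. -/
def cochainMap {G : Type} (A : Type) [AddCommGroup A] (g : G) (n : ℕ) :
    ((Fin (n + 1) → G) → A) →ₗ[ℤ] ((Fin n → G) → A) where
  toFun f := fun h => ∑ i : Fin (n + 1), (-1 : ℤ) ^ (i : ℕ) • f (i.insertNth g h)
  map_add' f f' := by
    ext h
    simp [Finset.sum_add_distrib]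
  map_smul' r f := by
    ext h
    simp only [Pi.smul_apply, Finset.smul_sum, RingHom.id_apply]
    exact Finset.sum_congr rfl fun i _ => smul_comm _ _ _

theorem cochainMap_cons {G : Type} {A : Type} [AddCommGroup A]
    (g : G) (n : ℕ) (f : (Fin (n + 2) → G) → A) (a : G) (t : Fin n → G) :
    cochainMap A g (n + 1) f (Fin.cons a t) =
      f (Fin.cons g (Fin.cons a t)) - cochainMap A g n (fun u => f (Fin.cons a u)) t := by
  have key (i : Fin (n + 1)) : (Fin.insertNth (α := fun _ => G) i.succ g (Fin.cons a t)) =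
      (Fin.cons a (Fin.insertNth (α := fun _ => G) i g t) : Fin (n + 2) → G) := by
    funext k
    refine Fin.cases ?_ (fun k => ?_) k
    · simp
    · refine Fin.succAboveCases i ?_ (fun j => ?_) k
      · simp
      · simp
  simp only [cochainMap, LinearMap.coe_mk, AddHom.coe_mk]
  rw [Fin.sum_univ_succ]
  simp only [key]
  simp [pow_succ, sub_eq_add_neg]

theorem cochainMap_zero {G : Type} {A : Type} [AddCommGroup A]
    (g : G) (f : (Fin 1 → G) → A) (t : Fin 0 → G) :
    cochainMap A g 0 f t = f (Fin.cons g t) := by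
  simp [cochainMap]

/-- The differential of inhomogeneous cochains with trivial coefficients. -/
abbrev diff (G A : Type) [CommGroup G] [AddCommGroup A] (n : ℕ) :
    ((Fin n → G) → A) →ₗ[ℤ] ((Fin (n + 1) → G) → A) :=
  (inhomogeneousCochains.d (Rep.trivial ℤ G A) n).hom

theorem diff_apply {G : Type} [CommGroup G] {A : Type} [AddCommGroup A]
    (n : ℕ) (f : (Fin n → G) → A) (h : Fin (n + 1) → G) :
    diff G A n f h = f (fun i => h i.succ) +
      ∑ j : Fin (n + 1), (-1 : ℤ) ^ ((j : ℕ) + 1) • f (Fin.contractNth j (· * ·) h) := by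
  rfl

theorem contractNth_zero_cons {G : Type} [CommGroup G]
    (n : ℕ) (a b : G) (t : Fin n → G) :
    Fin.contractNth 0 (· * ·) (Fin.cons a (Fin.cons b t) : Fin (n + 2) → G) =
      Fin.cons (a * b) t := by
  funext k
  refine Fin.cases ?_ (fun k => ?_) k
  · simp [Fin.contractNth]
  · simp [Fin.contractNth]

theorem contractNth_succ_cons {G : Type} [CommGroup G]
    (n : ℕ) (j : Fin (n + 1)) (a : G) (t : Fin (n + 1) → G) :
    Fin.contractNth j.succ (· * ·) (Fin.cons a t : Fin (n + 2) → G) =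
      Fin.cons a (Fin.contractNth j (· * ·) t) := by
  funext k
  refine Fin.cases ?_ (fun k => ?_) k
  · simp [Fin.contractNth]
  · simp [Fin.contractNth]

theorem diff_cons {G : Type} [CommGroup G] {A : Type} [AddCommGroup A]
    (n : ℕ) (f : (Fin (n + 1) → G) → A) (a b : G) (t : Fin n → G) :
    diff G A (n + 1) f (Fin.cons a (Fin.cons b t)) =
      f (Fin.cons b t) - f (Fin.cons (a * b) t) + f (Fin.cons a t)
        - diff G A n (fun u => f (Fin.cons a u)) (Fin.cons b t) := by
  rw [diff_apply, diff_apply, Fin.sum_univ_succ]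
  simp only [contractNth_zero_cons, contractNth_succ_cons, Fin.cons_succ]
  simp [pow_succ]
  abel

/-- `d ∘ τ_g = - τ_g ∘ d` in positive degrees. -/
theorem diff_cochainMap {G : Type} [CommGroup G] {A : Type} [AddCommGroup A]
    (g : G) (n : ℕ) (f : (Fin (n + 1) → G) → A) :
    diff G A n (cochainMap A g n f) = - cochainMap A g (n + 1) (diff G A (n + 1) f) := by
  suffices H : ∀ h, diff G A n (cochainMap A g n f) h +
      cochainMap A g (n + 1) (diff G A (n + 1) f) h = 0 from
    funext fun h => eq_neg_of_add_eq_zero_left (H h)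
  induction n with
  | zero =>
    intro h
    obtain ⟨a, t, rfl⟩ : ∃ a t, h = Fin.cons a t := ⟨h 0, Fin.tail h, by simp⟩
    have e1 (u : Fin 0 → G) : u = t := Subsingleton.elim _ _
    rw [cochainMap_cons, cochainMap_zero, diff_cons, diff_cons, mul_comm a g]
    simp only [diff_apply, e1]
    simp
    abel
  | succ m ih =>
    intro h
    obtain ⟨a, t, rfl⟩ : ∃ a t, h = Fin.cons a t := ⟨h 0, Fin.tail h, by simp⟩
    obtain ⟨b, t, rfl⟩ : ∃ b s, t = Fin.cons b s := ⟨t 0, Fin.tail t, by simp⟩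
    have IH := ih (fun u => f (Fin.cons a u)) (Fin.cons b t)
    have E1 : (fun u => cochainMap A g (m + 1) f (Fin.cons a u)) =
        (fun u => f (Fin.cons g (Fin.cons a u))) - cochainMap A g m (fun u => f (Fin.cons a u)) := by
      funext u
      exact cochainMap_cons _ _ _ _ _
    have E2 : (fun u => diff G A (m + 2) f (Fin.cons a (Fin.cons b u))) =
        (fun u => f (Fin.cons b u)) - (fun u => f (Fin.cons (a * b) u)) +
          (fun u => f (Fin.cons a u)) -
          fun u => diff G A (m + 1) (fun u => f (Fin.cons a u)) (Fin.cons b u) := by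
      funext u
      exact diff_cons _ _ _ _ _
    rw [diff_cons, E1, cochainMap_cons, cochainMap_cons, cochainMap_cons, map_sub,
      cochainMap_cons, cochainMap_cons, E2, map_sub, map_add, map_sub, diff_cons, diff_cons,
      diff_cons, mul_comm a g]
    rw [cochainMap_cons] at IH
    simp only [Pi.sub_apply, Pi.add_apply] at IH ⊢
    rw [← sub_eq_zero] at IH
    rw [← IH]
    abel

/-- `τ_g ∘ d = 0` on cochains of degree zero. -/
theorem cochainMap_diff_zero {G : Type} [CommGroup G] {A : Type} [AddCommGroup A]
    (g : G) (f : (Fin 0 → G) → A) :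
    cochainMap A g 0 (diff G A 0 f) = 0 := by
  funext h
  have e1 (u : Fin 0 → G) : u = h := Subsingleton.elim _ _
  simp [cochainMap, diff_apply, e1]

/-- The cochain map `τ_g` as a morphism between terms of the complex of inhomogeneous cochains. -/
noncomputable def cochainHom {G : Type} [CommGroup G] (A : Type) [AddCommGroup A]
    (g : G) (n : ℕ) :
    (groupCohomology.inhomogeneousCochains (Rep.trivial ℤ G A)).X (n + 1) ⟶
      (groupCohomology.inhomogeneousCochains (Rep.trivial ℤ G A)).X n :=
  ModuleCat.ofHom (cochainMap A g n)

theorem cochainHom_d {G : Type} [CommGroup G] {A : Type} [AddCommGroup A]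
    (g : G) (n : ℕ) :
    cochainHom A g n ≫ (groupCohomology.inhomogeneousCochains (Rep.trivial ℤ G A)).d n (n + 1) =
      - (groupCohomology.inhomogeneousCochains (Rep.trivial ℤ G A)).d (n + 1) (n + 2) ≫
        cochainHom A g (n + 1) := by
  rw [groupCohomology.inhomogeneousCochains.d_def, groupCohomology.inhomogeneousCochains.d_def]
  refine ModuleCat.hom_ext (LinearMap.ext fun f => ?_)
  exact diff_cochainMap g n f

theorem d_cochainHom_zero {G : Type} [CommGroup G] {A : Type} [AddCommGroup A]
    (g : G) :
    (groupCohomology.inhomogeneousCochains (Rep.trivial ℤ G A)).d 0 1 ≫ cochainHom A g 0 = 0 := by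
  rw [groupCohomology.inhomogeneousCochains.d_def]
  refine ModuleCat.hom_ext (LinearMap.ext fun f => ?_)
  exact cochainMap_diff_zero g f

/-- The map induced by `τ_g` on cocycles. -/
noncomputable def cocyclesHom {G : Type} [CommGroup G] (A : Type) [AddCommGroup A]
    (g : G) (n : ℕ) :
    groupCohomology.cocycles (Rep.trivial ℤ G A) (n + 1) ⟶
      groupCohomology.cocycles (Rep.trivial ℤ G A) n :=
  HomologicalComplex.liftCycles _
    (groupCohomology.iCocycles (Rep.trivial ℤ G A) (n + 1) ≫ cochainHom A g n) (n + 1) (by simp)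
    (by
      rw [Category.assoc, cochainHom_d, Preadditive.comp_neg, HomologicalComplex.iCycles_d_assoc,
        Limits.zero_comp, neg_zero])

theorem toCocycles_cocyclesHom {G : Type} [CommGroup G] {A : Type} [AddCommGroup A]
    (g : G) (n : ℕ) :
    groupCohomology.toCocycles (Rep.trivial ℤ G A) n (n + 1) ≫ cocyclesHom A g n ≫
      groupCohomology.π (Rep.trivial ℤ G A) n = 0 := by
  have h : groupCohomology.toCocycles (Rep.trivial ℤ G A) n (n + 1) ≫ cocyclesHom A g n =
      HomologicalComplex.liftCycles _
        ((groupCohomology.inhomogeneousCochains (Rep.trivial ℤ G A)).d n (n + 1) ≫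
          cochainHom A g n) (n + 1) (by simp)
        (by rw [Category.assoc, cochainHom_d, Preadditive.comp_neg,
          HomologicalComplex.d_comp_d_assoc, Limits.zero_comp, neg_zero]) := by
    rw [← cancel_mono (HomologicalComplex.iCycles _ _), cocyclesHom, Category.assoc,
      HomologicalComplex.liftCycles_i, HomologicalComplex.liftCycles_i,
      HomologicalComplex.toCycles_i_assoc]
  rw [← Category.assoc, h]
  cases n with
  | zero =>
    refine HomologicalComplex.liftCycles_homologyπ_eq_zero_of_boundary _ _ 1 (by simp)
      (i' := 0) 0 ?_
    rw [d_cochainHom_zero, Limits.zero_comp]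
  | succ m =>
    refine HomologicalComplex.liftCycles_homologyπ_eq_zero_of_boundary _ _ (m + 2) (by simp)
      (i' := m) (-cochainHom A g m) ?_
    rw [Preadditive.neg_comp, cochainHom_d, neg_neg]

end Transgression

/-- The transgression map `τ_g : Hⁿ⁺¹(G, A) → Hⁿ(G, A)` of an abelian group `G`, for `A` an abelian
group with trivial action: the class of a cocycle `f` is sent to the class of the cocycle
`(h₁, …, hₙ) ↦ ∑_{i = 0}^{n} (-1)^i f(h₁, …, hᵢ, g, hᵢ₊₁, …, hₙ)`. -/
noncomputable def transgression {G : Type} [CommGroup G] (A : Type) [AddCommGroup A]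
    (g : G) (n : ℕ) :
    groupCohomology (Rep.trivial ℤ G A) (n + 1) ⟶ groupCohomology (Rep.trivial ℤ G A) n :=
  (HomologicalComplex.homologyIsCokernel
    (groupCohomology.inhomogeneousCochains (Rep.trivial ℤ G A)) n (n + 1) (by simp)).desc
    (Limits.CokernelCofork.ofπ
      (Transgression.cocyclesHom A g n ≫ groupCohomology.π (Rep.trivial ℤ G A) n)
      (Transgression.toCocycles_cocyclesHom g n))

theorem π_transgression {G : Type} [CommGroup G] (A : Type) [AddCommGroup A] (g : G) (n : ℕ) :
    groupCohomology.π (Rep.trivial ℤ G A) (n + 1) ≫ transgression A g n =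
      Transgression.cocyclesHom A g n ≫ groupCohomology.π (Rep.trivial ℤ G A) n :=
  (HomologicalComplex.homologyIsCokernel
    (groupCohomology.inhomogeneousCochains (Rep.trivial ℤ G A)) n (n + 1) (by simp)).fac _
    Limits.WalkingParallelPair.one

/-! Induct on `G = K × ⟨t⟩` with `t` of order dividing `n`. Work with homogeneous cochains, i.e.
functions on lists of vertices, so that a cochain on `G` may be invariant under `K` only. There
`τ_g` is the prism homotopy from the identity to translation by `g`: `d τ_g + τ_g d = g - 1`
(`d_tau`).

Let `π` be a 4-cocycle with `τ_g π = d ρ_g` for all `g`. By induction its restriction to `K` is a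
coboundary, hence `π = dα` with `α` invariant under `K` (`exists_primitive`). The defect of
`G`-invariance is exact: `tα - α = dβ` with `β = τ_t α + ρ_t`. If the norm `N = 1 + t + ... +
t^(n-1)` kills `β`, then `β = tW - W` with `W` invariant under `K`, because such cochains form a
coinduced `⟨t⟩`-module; now `α - dW` is a `G`-invariant primitive (`exists_inv_primitive`).

So `β` has to be corrected by a `K`-invariant cocycle until its norm vanishes. The obstruction is
the `G`-invariant 2-cocycle `b = Nβ`. For divisible coefficients, a 2-cocycle is a coboundary as
soon as its commutator pairing vanishes (`exists_primitive_of_symmetric`, by the same induction two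
degrees lower). The remaining transgressions `τ_k π = d ρ_k`, `k ∈ K`, show that each slice of the
pairing of `b` at `k` is `n` times a character of `K` (`exists_character`). Hence the pairing is `n`
times the antisymmetrization of a bicharacter `s` of `K` (`exists_antisymmetrization`). With `σ` the
2-cocycle of `s` pulled back to `G`, `Nσ = nσ` and `b - nσ` is a coboundary `dγ`; since `γ` is
itself a norm, `β` can be corrected. -/

namespace ListCochain

/-! ### The augmented simplicial complex of cochains on lists of vertices -/

section Basic

variable {X Y Z A : Type} [AddCommGroup A]

/-- The underlying function of `ListCochain.d`. -/
def dFun : (List X → A) → List X → A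
  | _, [] => 0
  | F, a :: l => F l - dFun (fun l' => F (a :: l')) l

theorem dFun_add (F F' : List X → A) (l : List X) : dFun (F + F') l = dFun F l + dFun F' l := by
  induction l generalizing F F' with
  | nil => simp [dFun]
  | cons a l ih =>
    have := ih (fun l' => F (a :: l')) (fun l' => F' (a :: l'))
    simp only [dFun, Pi.add_apply]
    rw [show (fun l' => F (a :: l') + F' (a :: l')) =
      (fun l' => F (a :: l')) + (fun l' => F' (a :: l')) from rfl, this]
    abel

/-- The augmented simplicial differential on homogeneous cochains of all degrees, viewed as
functions on lists of vertices. -/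
def d : (List X → A) →+ (List X → A) :=
  AddMonoidHom.mk' dFun fun F F' => funext fun l => dFun_add F F' l

@[simp] theorem d_nil (F : List X → A) : d F [] = 0 := rfl

theorem d_cons (F : List X → A) (a : X) (l : List X) :
    d F (a :: l) = F l - d (fun l' => F (a :: l')) l := rfl

theorem d_pair (F : List X → A) (a b : X) : d F [a, b] = F [b] - F [a] := by
  simp [d_cons]

theorem d_triple (F : List X → A) (a b c : X) :
    d F [a, b, c] = F [b, c] - F [a, c] + F [a, b] := by
  simp [d_cons]; abel

theorem d_quadruple (F : List X → A) (a b c e : X) :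
    d F [a, b, c, e] = F [b, c, e] - F [a, c, e] + F [a, b, e] - F [a, b, c] := by
  simp [d_cons]; abel

theorem d_congr {F F' : List X → A} (l : List X)
    (h : ∀ l', l'.length + 1 = l.length → F l' = F' l') : d F l = d F' l := by
  induction l generalizing F F' with
  | nil => rfl
  | cons a l ih =>
    rw [d_cons, d_cons, h l (by simp), ih fun l' hl' => h _ (by simpa using hl')]

theorem d_d (F : List X → A) : d (d F) = 0 := by
  funext l
  induction l generalizing F with
  | nil => rfl
  | cons a l ih =>
    rw [d_cons, show (fun l' => d F (a :: l')) = F - d (fun l' => F (a :: l')) from rfl, map_sub]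
    simp [ih]

/-- Pullback of cochains along a map of vertices. -/
def pull (w : X → Y) : (List Y → A) →+ (List X → A) where
  toFun F := fun l => F (l.map w)
  map_zero' := rfl
  map_add' _ _ := rfl

theorem pull_apply (w : X → Y) (F : List Y → A) (l : List X) : pull w F l = F (l.map w) := rfl

theorem pull_pull (w : X → Y) (v : Y → Z) (F : List Z → A) :
    pull w (pull v F) = pull (v ∘ w) F := by
  funext l
  simp [pull_apply]

theorem pull_id (F : List X → A) : pull id F = F := by
  funext l
  simp [pull_apply]

theorem d_pull (w : X → Y) (F : List Y → A) : d (pull w F) = pull w (d F) := by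
  funext l
  induction l generalizing F with
  | nil => rfl
  | cons a l ih =>
    rw [d_cons, pull_apply, pull_apply, List.map_cons, d_cons, ← pull_apply w (d _), ← ih]
    rfl

/-- The underlying function of `ListCochain.prism`. -/
def prismFun (u v : X → Y) : (List Y → A) → List X → A
  | _, [] => 0
  | F, a :: l => F (u a :: v a :: l.map v) - prismFun u v (fun l' => F (u a :: l')) l

theorem prismFun_add (u v : X → Y) (F F' : List Y → A) (l : List X) :
    prismFun u v (F + F') l = prismFun u v F l + prismFun u v F' l := by
  induction l generalizing F F' with
  | nil => simp [prismFun]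
  | cons a l ih =>
    have := ih (fun l' => F (u a :: l')) (fun l' => F' (u a :: l'))
    simp only [prismFun, Pi.add_apply]
    rw [show (fun l' => F (u a :: l') + F' (u a :: l')) =
      (fun l' => F (u a :: l')) + (fun l' => F' (u a :: l')) from rfl, this]
    abel

/-- The prism operator, a homotopy between the pullbacks along two maps of vertices. -/
def prism (u v : X → Y) : (List Y → A) →+ (List X → A) :=
  AddMonoidHom.mk' (prismFun u v) fun F F' => funext fun l => prismFun_add u v F F' l

@[simp] theorem prism_nil (u v : X → Y) (F : List Y → A) : prism u v F [] = 0 := rfl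

theorem prism_cons (u v : X → Y) (F : List Y → A) (a : X) (l : List X) :
    prism u v F (a :: l) = F (u a :: v a :: l.map v) - prism u v (fun l' => F (u a :: l')) l := rfl

theorem prism_pair (u v : X → Y) (F : List Y → A) (a b : X) :
    prism u v F [a, b] = F [u a, v a, v b] - F [u a, u b, v b] := by
  simp [prism_cons]

theorem prism_congr (u v : X → Y) {F F' : List Y → A} (l : List X)
    (h : ∀ l', l'.length = l.length + 1 → F l' = F' l') : prism u v F l = prism u v F' l := by
  induction l generalizing F F' with
  | nil => rfl
  | cons a l ih =>
    rw [prism_cons, prism_cons, h _ (by simp), ih fun l' hl' => h _ (by simpa using hl')]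

theorem d_prism (u v : X → Y) (F : List Y → A) :
    d (prism u v F) = pull v F - pull u F - prism u v (d F) := by
  funext l
  simp only [Pi.sub_apply]
  induction l generalizing F with
  | nil => simp [pull_apply]
  | cons a l ih =>
    have e1 : (fun l' => prism u v F (a :: l')) =
        pull v (fun l' => F (u a :: v a :: l')) - prism u v (fun l' => F (u a :: l')) := rfl
    have e2 : (fun l' => d F (u a :: l')) = F - d (fun l' => F (u a :: l')) := rfl
    rw [d_cons, e1, prism_cons, e2, map_sub, map_sub, Pi.sub_apply, Pi.sub_apply, ih, d_pull,
      d_cons, d_cons]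
    simp only [pull_apply, List.map_cons]
    abel

/-- Naturality of the prism. It gives both the invariance of transgressions and homotopies under
translation, and the compatibility of transgression with restriction to a subgroup. -/
theorem pull_prism {X' Y' : Type} (u v : X → Y) (u' v' : X' → Y') (w : X' → X) (w' : Y' → Y)
    (hu : ∀ x, u (w x) = w' (u' x)) (hv : ∀ x, v (w x) = w' (v' x)) (F : List Y → A) :
    pull w (prism u v F) = prism u' v' (pull w' F) := by
  funext l
  induction l generalizing F with
  | nil => rfl
  | cons a l ih =>
    have := ih (fun l' => F (u (w a) :: l'))
    rw [pull_apply] at this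
    rw [pull_apply, List.map_cons, prism_cons, prism_cons, this]
    have e1 : (fun l' => pull w' F (u' a :: l')) = pull w' (fun l' => F (u (w a) :: l')) := by
      funext l'
      simp [pull_apply, hu]
    have e2 : (l.map w).map v = (l.map v').map w' := by
      simp [hv]
    rw [e1, e2, pull_apply, List.map_cons, List.map_cons, hu, hv]

/-- The part of a cochain supported on lists of length `n`. -/
def trunc (n : ℕ) (F : List X → A) : List X → A := fun l => if l.length = n then F l else 0

theorem trunc_of_length {n : ℕ} (F : List X → A) {l : List X} (h : l.length = n) :
    trunc n F l = F l := if_pos h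

theorem trunc_of_length_ne {n : ℕ} (F : List X → A) {l : List X} (h : l.length ≠ n) :
    trunc n F l = 0 := if_neg h

theorem trunc_trunc (n : ℕ) (F : List X → A) : trunc n (trunc n F) = trunc n F := by
  funext l
  by_cases h : l.length = n <;> simp [trunc, h]

theorem d_trunc (n : ℕ) (F : List X → A) : d (trunc n F) = trunc (n + 1) (d F) := by
  funext l
  by_cases h : l.length = n + 1
  · rw [trunc_of_length _ h]
    exact d_congr l fun l' hl' => trunc_of_length _ (by omega)
  · rw [trunc_of_length_ne _ h, d_congr (F' := 0) l fun l' hl' => trunc_of_length_ne _ (by omega)]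
    simp

theorem pull_trunc (n : ℕ) (w : X → Y) (F : List Y → A) :
    pull w (trunc n F) = trunc n (pull w F) := by
  funext l
  simp [trunc, pull_apply]

end Basic

/-! ### Translation, transgression and invariant cochains -/

section Invariant

variable {G K A : Type} [CommGroup G] [AddCommGroup A]

/-- Translation of cochains by a group element. -/
abbrev shift (g : G) : (List G → A) →+ (List G → A) := pull (g * ·)

/-- Transgression of homogeneous cochains. -/
abbrev tau (g : G) : (List G → A) →+ (List G → A) := prism id (g * ·)

theorem shift_shift (g h : G) (F : List G → A) : shift g (shift h F) = shift (g * h) F := by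
  have : ((h * ·) ∘ (g * ·) : G → G) = (g * h * ·) :=
    funext fun x => by simp [mul_left_comm, mul_assoc]
  rw [shift, shift, shift, pull_pull, this]

theorem shift_one (F : List G → A) : shift 1 F = F := by
  funext l
  simp [pull_apply]

theorem shift_tau (g h : G) (F : List G → A) : shift g (tau h F) = tau h (shift g F) :=
  pull_prism id (h * ·) id (h * ·) (g * ·) (g * ·) (fun _ => rfl)
    (fun _ => mul_left_comm _ _ _) F

theorem d_shift (g : G) (F : List G → A) : d (shift g F) = shift g (d F) := d_pull _ _

/-- The prism identity for the homotopy from the identity to `(g * ·)`. On cochains fixed by `g` it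
makes `τ_g` anticommute with `d`; on the others it measures the failure of invariance. -/
theorem d_tau (g : G) (F : List G → A) : d (tau g F) = shift g F - F - tau g (d F) := by
  rw [d_prism, pull_id]

theorem tau_d (g : G) (F : List G → A) : tau g (d F) = shift g F - F - d (tau g F) := by
  rw [d_tau]; abel

/-- Invariance of cochains on `G` under translation by the image of `φ`. -/
def Inv (φ : K → G) (F : List G → A) : Prop := ∀ k, shift (φ k) F = F

variable {φ : K → G} {F F' : List G → A}

theorem Inv.add (h : Inv φ F) (h' : Inv φ F') : Inv φ (F + F') := fun k => by
  rw [map_add, h, h']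

theorem Inv.sub (h : Inv φ F) (h' : Inv φ F') : Inv φ (F - F') := fun k => by
  rw [map_sub, h, h']

theorem Inv.d (h : Inv φ F) : Inv φ (d F) := fun k => by rw [← d_shift, h]

theorem Inv.tau (h : Inv φ F) (g : G) : Inv φ (tau g F) := fun k => by rw [shift_tau, h]

theorem Inv.trunc (h : Inv φ F) (n : ℕ) : Inv φ (trunc n F) := fun k => by
  rw [shift, pull_trunc, h]

theorem Inv.shift (h : Inv φ F) (g : G) : Inv φ (shift g F) := fun k => by
  rw [shift_shift, mul_comm, ← shift_shift, h]

theorem Inv.nsmul (h : Inv φ F) (n : ℕ) : Inv φ (n • F) := fun k => by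
  rw [map_nsmul, h]

theorem Inv.sum {ι : Type} {s : Finset ι} {F : ι → List G → A} (h : ∀ j ∈ s, Inv φ (F j)) :
    Inv φ (∑ j ∈ s, F j) := fun k => by
  rw [map_sum]
  exact Finset.sum_congr rfl fun j hj => h j hj k

theorem Inv.comp (h : Inv (id : G → G) F) : Inv φ F := fun k => h (φ k)

theorem Inv.apply (h : Inv φ F) (k : K) (l : List G) : F (l.map (φ k * ·)) = F l :=
  congrFun (h k) l

end Invariant

/-! ### Cochains on tuples as functions on lists -/

section OfFin

variable {G A : Type} [AddCommGroup A]

/-- A function of `n` arguments as a function of lists supported in length `n`. -/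
def ofFin : (n : ℕ) → ((Fin n → G) → A) → List G → A
  | 0, f, [] => f Fin.elim0
  | 0, _, _ :: _ => 0
  | _ + 1, _, [] => 0
  | n + 1, f, a :: l => ofFin n (fun t => f (Fin.cons a t)) l

theorem exists_ofFn_eq {n : ℕ} {l : List G} (h : l.length = n) :
    ∃ t : Fin n → G, List.ofFn t = l := by
  subst h
  exact ⟨l.get, List.ofFn_get l⟩

theorem ofFin_ofFn (n : ℕ) (f : (Fin n → G) → A) (h : Fin n → G) :
    ofFin n f (List.ofFn h) = f h := by
  induction n with
  | zero =>
    rw [List.ofFn_zero, ofFin]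
    exact congrArg f (Subsingleton.elim _ _)
  | succ n ih =>
    rw [List.ofFn_succ, ofFin, ih]
    exact congrArg f (Fin.cons_self_tail h)

theorem ofFin_of_length_ne (n : ℕ) (f : (Fin n → G) → A) {l : List G} (h : l.length ≠ n) :
    ofFin n f l = 0 := by
  induction n generalizing l with
  | zero => cases l with
    | nil => simp at h
    | cons a l => rfl
  | succ n ih => cases l with
    | nil => rfl
    | cons a l => exact ih _ (by simpa using h)

theorem ofFin_eq_trunc (n : ℕ) (F : List G → A) :
    ofFin n (fun t => F (List.ofFn t)) = trunc n F := by
  funext l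
  by_cases h : l.length = n
  · rw [trunc_of_length _ h]
    obtain ⟨t, rfl⟩ := exists_ofFn_eq h
    rw [ofFin_ofFn]
  · rw [trunc_of_length_ne _ h, ofFin_of_length_ne _ _ h]

theorem ofFin_sub (n : ℕ) (f f' : (Fin n → G) → A) (l : List G) :
    ofFin n (fun t => f t - f' t) l = ofFin n f l - ofFin n f' l := by
  by_cases h : l.length = n
  · obtain ⟨t, rfl⟩ := exists_ofFn_eq h
    simp only [ofFin_ofFn]
  · simp [ofFin_of_length_ne _ _ h]

theorem ofFin_add (n : ℕ) (f f' : (Fin n → G) → A) (l : List G) :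
    ofFin n (fun t => f t + f' t) l = ofFin n f l + ofFin n f' l := by
  by_cases h : l.length = n
  · obtain ⟨t, rfl⟩ := exists_ofFn_eq h
    simp only [ofFin_ofFn]
  · simp [ofFin_of_length_ne _ _ h]

theorem ofFin_injective (n : ℕ) :
    Function.Injective (ofFin n : ((Fin n → G) → A) → List G → A) := by
  intro f f' h
  funext t
  rw [← ofFin_ofFn n f, h, ofFin_ofFn]

theorem exists_ofFin_eq_trunc (n : ℕ) (F : List G → A) : ∃ f, ofFin n f = trunc n F :=
  ⟨_, ofFin_eq_trunc n F⟩

theorem trunc_ofFin (n : ℕ) (f : (Fin n → G) → A) : trunc n (ofFin n f) = ofFin n f := by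
  funext l
  by_cases h : l.length = n
  · rw [trunc_of_length _ h]
  · rw [trunc_of_length_ne _ h, ofFin_of_length_ne _ _ h]

/-- Transgression on functions of lists. -/
def inhomTau (g : G) : (List G → A) → List G → A
  | F, [] => F [g]
  | F, a :: t => F (g :: a :: t) - inhomTau g (fun l => F (a :: l)) t

theorem ofFin_cochainMap (g : G) (n : ℕ) (f : (Fin (n + 1) → G) → A) :
    ofFin n (Transgression.cochainMap A g n f) = inhomTau g (ofFin (n + 1) f) := by
  funext l
  induction n generalizing l with
  | zero =>
    rcases l with _ | ⟨a, l⟩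
    · simp only [ofFin, inhomTau, Transgression.cochainMap_zero]
    · have (l : List G) (F : List G → A) (h : ∀ l, 2 ≤ l.length → F l = 0) (hl : l ≠ []) :
          inhomTau g F l = 0 := by
        induction l generalizing F with
        | nil => exact absurd rfl hl
        | cons a l ih =>
          rw [inhomTau, h _ (by simp)]
          rcases l with _ | ⟨b, l⟩
          · simp [inhomTau, h]
          · rw [ih _ (fun l hl => h _ (by simp; omega)) (by simp)]
            simp
      rw [this _ _ (fun l hl => ofFin_of_length_ne _ _ (by omega)) (by simp)]
      rfl
  | succ n ih =>
    rcases l with _ | ⟨a, l⟩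
    · rfl
    · have := ih (fun t => f (Fin.cons a t)) l
      rw [inhomTau]
      simp only [ofFin] at this ⊢
      simp only [Transgression.cochainMap_cons, ofFin_sub, this]

end OfFin

/-! ### Homogeneous versus inhomogeneous cochains -/

section Inhomogeneous

variable {G A : Type} [CommGroup G] [AddCommGroup A]

/-- The inhomogeneous differential with trivial coefficients, on functions of lists. -/
def inhomD : (List G → A) → List G → A
  | _, [] => 0
  | _, [_] => 0
  | F, a :: b :: t => F (b :: t) - F (a * b :: t) + F (a :: t) -
      inhomD (fun l => F (a :: l)) (b :: t)

/-- The successive quotients of the list `x :: l`. -/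
def quotients : G → List G → List G
  | _, [] => []
  | x, y :: l => x⁻¹ * y :: quotients y l

/-- The homogeneous cochain attached to an inhomogeneous one. -/
def homog (F : List G → A) : List G → A
  | [] => 0
  | x :: l => F (quotients x l)

@[simp] theorem length_quotients (x : G) (l : List G) : (quotients x l).length = l.length := by
  induction l generalizing x with
  | nil => rfl
  | cons y l ih => simp [quotients, ih]

theorem quotients_map_mul (g x : G) (l : List G) :
    quotients (g * x) (l.map (g * ·)) = quotients x l := by
  induction l generalizing x with
  | nil => rfl
  | cons y l ih =>
    simp only [List.map_cons, quotients, ih]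
    congr 1
    group

theorem homog_inv (F : List G → A) : Inv id (homog F) := fun g => funext fun l => by
  cases l with
  | nil => rfl
  | cons x l => simp [pull_apply, homog, quotients_map_mul]

theorem d_homog_aux (F : List G → A) (x : G) (l : List G) :
    d (fun l' => F (quotients x l')) l = homog F l - inhomD F (quotients x l) := by
  induction l generalizing F x with
  | nil => simp [homog, quotients, inhomD]
  | cons y l ih =>
    have := ih (fun l' => F (x⁻¹ * y :: l')) y
    rw [d_cons]
    simp only [quotients] at this ⊢
    rw [this]
    cases l with
    | nil => simp [homog, quotients, inhomD]
    | cons z l =>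
      have e : x⁻¹ * y * (y⁻¹ * z) = x⁻¹ * z := by group
      simp only [quotients, homog, inhomD, e]
      abel

theorem d_homog (F : List G → A) : d (homog F) = homog (inhomD F) := by
  funext l
  cases l with
  | nil => rfl
  | cons x l =>
    have := d_homog_aux F x l
    rw [d_cons]
    simp only [homog] at this ⊢
    rw [this]
    exact sub_sub_cancel _ _

theorem tau_homog_aux (g : G) (F : List G → A) (x : G) (l : List G) :
    tau g (fun l' => F (quotients x l')) l =
      F (g :: quotients x l) - inhomTau g F (quotients x l) := by
  induction l generalizing F x with
  | nil => simp [quotients, inhomTau]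
  | cons y l ih =>
    have := ih (fun l' => F (x⁻¹ * y :: l')) y
    have e : y⁻¹ * (g * y) = g := by rw [mul_comm g, inv_mul_cancel_left]
    rw [tau, prism_cons]
    simp only [quotients, id, quotients_map_mul, e, inhomTau] at this ⊢
    rw [this]
    abel

/-- The step from `x` to `g * x` at the break of the prism has quotient `x⁻¹ * (g * x) = g`, as `G`
is commutative; all other quotients are unchanged by translation. So the prism inserts `g` in every
position with alternating sign. -/
theorem tau_homog (g : G) (F : List G → A) : tau g (homog F) = homog (inhomTau g F) := by
  funext l
  cases l with
  | nil => rfl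
  | cons x l =>
    have := tau_homog_aux g F x l
    have e : x⁻¹ * (g * x) = g := by rw [mul_comm g, inv_mul_cancel_left]
    rw [tau, prism_cons]
    simp only [homog, quotients, id, quotients_map_mul, e]
    rw [this]
    abel

theorem ofFin_diff (n : ℕ) (f : (Fin n → G) → A) :
    ofFin (n + 1) (Transgression.diff G A n f) = inhomD (ofFin n f) := by
  funext l
  induction n generalizing l with
  | zero =>
    rcases l with _ | ⟨a, _ | ⟨b, l⟩⟩
    · rfl
    · simp only [ofFin, inhomD, Transgression.diff_apply]
      have e (u v : Fin 0 → G) : f u = f v := congrArg f (Subsingleton.elim _ _)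
      simp [e _ Fin.elim0]
    · have (l : List G) (F : List G → A) (h : ∀ l, l ≠ [] → F l = 0) (hl : 2 ≤ l.length) :
          inhomD F l = 0 := by
        induction l generalizing F with
        | nil => rfl
        | cons a l ih =>
          rcases l with _ | ⟨b, _ | ⟨c, l⟩⟩
          · rfl
          · simp [inhomD, h]
          · rw [inhomD, ih _ (fun l _ => h _ (by simp)) (by simp), h _ (by simp), h _ (by simp),
              h _ (by simp)]
            simp
      rw [this _ _ (fun l hl => by cases l with | nil => exact absurd rfl hl | cons _ _ => rfl)
        (by simp)]
      rfl
  | succ n ih =>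
    rcases l with _ | ⟨a, _ | ⟨b, l⟩⟩
    · rfl
    · rfl
    · have := ih (fun t => f (Fin.cons a t)) (b :: l)
      rw [inhomD]
      simp only [ofFin] at this ⊢
      simp only [Transgression.diff_cons, ofFin_sub, ofFin_add, this]

theorem homog_zero : homog (0 : List G → A) = 0 := by
  funext l
  cases l <;> rfl

theorem trunc_homog (n : ℕ) (F : List G → A) : trunc (n + 1) (homog F) = homog (trunc n F) := by
  funext l
  cases l with
  | nil => rfl
  | cons x l => simp [trunc, homog]

/-- The partial products `x * h₁`, `x * h₁ * h₂`, … -/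
def products : G → List G → List G
  | _, [] => []
  | x, h :: l => x * h :: products (x * h) l

theorem quotients_products (x : G) (l : List G) : quotients x (products x l) = l := by
  induction l generalizing x with
  | nil => rfl
  | cons y l ih => simp [quotients, products, ih]

theorem products_quotients (x : G) (l : List G) : products x (quotients x l) = l := by
  induction l generalizing x with
  | nil => rfl
  | cons y l ih => simp [quotients, products, ih]

theorem homog_injective : Function.Injective (homog : (List G → A) → List G → A) := by
  intro F F' h
  funext l
  have := congrFun h (1 :: products 1 l)
  simpa [homog, quotients_products] using this

theorem exists_homog_eq_trunc {F : List G → A} (hF : Inv id F) (n : ℕ) :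
    ∃ F', homog F' = trunc (n + 1) F := by
  refine ⟨trunc n fun l => F (1 :: products 1 l), ?_⟩
  rw [← trunc_homog]
  funext l
  by_cases h : l.length = n + 1
  · rw [trunc_of_length _ h, trunc_of_length _ h]
    cases l with
    | nil => simp at h
    | cons x l =>
      have := hF.apply x⁻¹ (x :: l)
      rw [← this, homog, ← quotients_map_mul x⁻¹]
      simp [products_quotients]
  · rw [trunc_of_length_ne _ h, trunc_of_length_ne _ h]

end Inhomogeneous

/-- A cocycle is a coboundary if its homogeneous version is the differential of an invariant
cochain. -/
theorem exists_diff_eq {G A : Type} [CommGroup G] [AddCommGroup A] (n : ℕ)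
    (f : (Fin (n + 1) → G) → A) (α : List G → A) (hα : Inv id α)
    (h : d α = homog (ofFin (n + 1) f)) : ∃ a, Transgression.diff G A n a = f := by
  obtain ⟨F, hF⟩ := exists_homog_eq_trunc hα n
  obtain ⟨a, ha⟩ := exists_ofFin_eq_trunc n F
  refine ⟨a, ofFin_injective _ (homog_injective ?_)⟩
  rw [ofFin_diff, ← d_homog, ha, ← trunc_homog, hF, trunc_trunc, d_trunc, h, trunc_homog,
    trunc_ofFin]

/-! ### Vanishing of cohomology classes in terms of cochains -/

theorem π_eq_zero_iff {G A : Type} [CommGroup G] [AddCommGroup A] (n : ℕ)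
    (z : groupCohomology.cocycles (Rep.trivial ℤ G A) (n + 1)) :
    groupCohomology.π (Rep.trivial ℤ G A) (n + 1) z = 0 ↔
      ∃ a, Transgression.diff G A n a =
        groupCohomology.iCocycles (Rep.trivial ℤ G A) (n + 1) z := by
  set C := groupCohomology.inhomogeneousCochains (Rep.trivial ℤ G A)
  have hd : C.d n (n + 1) = ModuleCat.ofHom (Transgression.diff G A n) :=
    groupCohomology.inhomogeneousCochains.d_def _ n
  have key (a : (Fin n → G) → A) :
      C.iCycles (n + 1) (C.toCycles n (n + 1) a) = Transgression.diff G A n a := by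
    have := C.toCycles_i n (n + 1)
    rw [hd] at this
    exact congr($(this).hom a)
  constructor
  · intro h
    have ex : (ShortComplex.mk (C.toCycles n (n + 1)) (C.homologyπ (n + 1)) (by simp)).Exact :=
      ShortComplex.exact_of_g_is_cokernel _ (C.homologyIsCokernel n (n + 1) (by simp))
    obtain ⟨a, ha⟩ := (ShortComplex.moduleCat_exact_iff _).1 ex z h
    refine ⟨a, ?_⟩
    rw [← key]
    exact congrArg _ ha
  · rintro ⟨a, ha⟩
    have hz : C.toCycles n (n + 1) a = z := by
      apply (ModuleCat.mono_iff_injective (C.iCycles (n + 1))).1 inferInstance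
      exact (key a).trans ha
    rw [← hz]
    have := C.toCycles_comp_homologyπ n (n + 1)
    exact congr($(this).hom a)

theorem iCocycles_cocyclesHom {G A : Type} [CommGroup G] [AddCommGroup A] (g : G) (n : ℕ)
    (z : groupCohomology.cocycles (Rep.trivial ℤ G A) (n + 1)) :
    groupCohomology.iCocycles (Rep.trivial ℤ G A) n (Transgression.cocyclesHom A g n z) =
      Transgression.cochainMap A g n
        (groupCohomology.iCocycles (Rep.trivial ℤ G A) (n + 1) z) := by
  have : Transgression.cocyclesHom A g n ≫ groupCohomology.iCocycles (Rep.trivial ℤ G A) n =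
    groupCohomology.iCocycles (Rep.trivial ℤ G A) (n + 1) ≫ Transgression.cochainHom A g n :=
    HomologicalComplex.liftCycles_i _ _ _ _ _
  exact congr($(this).hom z)

/-! ### Divisibility of alternating bicharacters -/

section Bilinear

variable {A : Type} [AddCommGroup A]

/-- Put `g = gcd m m'` and `c = gcd g n`. The two solutions show that `y` is killed by `lcm m n / n`
and `lcm m' n / n`, whose gcd is `g / c`. If `c • w = y` then `g • w = 0`, and Bézout `c = g * a + n
* b` makes `b • w` a solution killed by `g`. -/
theorem exists_common_divisor (hA : ∀ n : ℕ, n ≠ 0 → ∀ a : A, ∃ a', n • a' = a)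
    {n m m' : ℕ} (hn : n ≠ 0) (hm : m ≠ 0) (hm' : m' ≠ 0) (y z z' : A)
    (hz : n • z = y) (hz' : n • z' = y)
    (mz : m • z = 0) (mz' : m' • z' = 0) : ∃ w, n • w = y ∧ m • w = 0 ∧ m' • w = 0 := by
  set g := m.gcd m' with hg
  have hg0 : g ≠ 0 := Nat.gcd_ne_zero_left hm
  set c := g.gcd n with hc
  have hc0 : c ≠ 0 := Nat.gcd_ne_zero_right hn
  have key {m : ℕ} {z : A} (hz : n • z = y) (mz : m • z = 0) : (Nat.lcm m n / n) • y = 0 := by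
    obtain ⟨r, hr⟩ := Nat.dvd_lcm_left m n
    rw [← hz, ← mul_smul, Nat.div_mul_cancel (Nat.dvd_lcm_right m n), hr, mul_comm, mul_smul, mz,
      smul_zero]
  have hgy : (g / c) • y = 0 := by
    have h1 := key hz mz
    have h2 := key hz' mz'
    have e : g / c = (m.lcm n / n).gcd (m'.lcm n / n) := by
      have : g.lcm n = (m.lcm n).gcd (m'.lcm n) := by
        refine Nat.eq_of_factorization_eq (Nat.lcm_ne_zero hg0 hn) (Nat.gcd_ne_zero_left
          (Nat.lcm_ne_zero hm hn)) fun p => ?_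
        rw [Nat.factorization_lcm hg0 hn, Nat.factorization_gcd hm hm',
          Nat.factorization_gcd (Nat.lcm_ne_zero hm hn) (Nat.lcm_ne_zero hm' hn),
          Nat.factorization_lcm hm hn, Nat.factorization_lcm hm' hn]
        exact sup_inf_right (m.factorization p) (m'.factorization p) (n.factorization p)
      rw [Nat.gcd_div (Nat.dvd_lcm_right m n) (Nat.dvd_lcm_right m' n), ← this, Nat.lcm, hc,
        mul_comm g n, Nat.mul_div_assoc _ (Nat.gcd_dvd_left g n), Nat.mul_div_cancel_left _
        (Nat.pos_of_ne_zero hn)]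
    rw [e]
    exact addOrderOf_dvd_iff_nsmul_eq_zero.1
      (Nat.dvd_gcd (addOrderOf_dvd_iff_nsmul_eq_zero.2 h1) (addOrderOf_dvd_iff_nsmul_eq_zero.2 h2))
  obtain ⟨w, hw⟩ := hA c hc0 y
  have hgw : g • w = 0 := by
    rw [← Nat.div_mul_cancel (Nat.gcd_dvd_left g n), mul_smul, hw, hgy]
  have bez : (c : ℤ) = g * g.gcdA n + n * g.gcdB n := Nat.gcd_eq_gcd_ab g n
  have hv : n • (g.gcdB n • w) = y := by
    rw [← hw, ← natCast_zsmul _ n, ← natCast_zsmul _ c, bez, add_smul, ← mul_smul, mul_comm (g : ℤ),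
      mul_smul _ (g : ℤ), natCast_zsmul _ g, hgw, smul_zero, zero_add]
  have hk {m : ℕ} (h : g ∣ m) : m • (g.gcdB n • w) = 0 := by
    obtain ⟨r, rfl⟩ := h
    rw [smul_comm, mul_comm, mul_smul, hgw, smul_zero, smul_zero]
  exact ⟨_, hv, hk (Nat.gcd_dvd_left _ _), hk (Nat.gcd_dvd_right _ _)⟩

theorem val_add_nsmul {m : ℕ} [NeZero m] {z : A} (hz : m • z = 0) (a b : ZMod m) :
    (a + b).val • z = a.val • z + b.val • z := by
  rw [ZMod.val_add, ← add_smul]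
  conv_rhs => rw [← Nat.mod_add_div (a.val + b.val) m, add_smul, mul_comm, mul_smul, hz, smul_zero,
    add_zero]

/-- A coordinate description of a finite abelian group. -/
theorem exists_coordinates (K : Type) [CommGroup K] [Finite K] :
    ∃ (ι : Type) (_ : Fintype ι) (m : ι → ℕ) (_ : ∀ i, NeZero (m i)) (e : ι → K)
      (c : ∀ i, K → ZMod (m i)), (∀ i, e i ^ m i = 1) ∧
      (∀ i k l, c i (k * l) = c i k + c i l) ∧ ∀ k, k = ∏ i, e i ^ (c i k).val := by
  classical
  obtain ⟨ι, hι, m, hm, ⟨f⟩⟩ := CommGroup.equiv_prod_multiplicative_zmod_of_finite K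
  have (i : ι) : NeZero (m i) := NeZero.of_gt (hm i)
  refine ⟨ι, hι, m, this, fun i => f.symm (Pi.mulSingle i (Multiplicative.ofAdd 1)),
    fun i k => (f k i).toAdd, fun i => ?_, fun i k l => by simp, fun k => ?_⟩
  · rw [← map_pow, ← Pi.mulSingle_pow, ← ofAdd_nsmul]
    simp
  · apply f.injective
    simp only [map_prod, map_pow, MulEquiv.apply_symm_apply, ← Pi.mulSingle_pow, ← ofAdd_nsmul]
    simp only [nsmul_eq_mul, ZMod.natCast_val, mul_one, ZMod.cast_id', id, ofAdd_toAdd]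
    exact (Finset.univ_prod_mulSingle (f k)).symm

variable {K : Type} [CommGroup K]

theorem map_prod_of_map_mul {φ : K → A} (h : ∀ k l, φ (k * l) = φ k + φ l) {ι : Type}
    (s : Finset ι) (e : ι → K) (r : ι → ℕ) :
    φ (∏ i ∈ s, e i ^ r i) = ∑ i ∈ s, r i • φ (e i) := by
  let ψ : K →* Multiplicative A := MonoidHom.mk' (fun k => .ofAdd (φ k)) fun k l => by
    rw [h]; rfl
  have := congrArg Multiplicative.toAdd (map_prod ψ (fun i => e i ^ r i) s)
  rw [toAdd_prod] at this
  simp only [map_pow, toAdd_pow] at this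
  exact this

/-- An alternating bicharacter all of whose slices are divisible by `n` is `n` times the
antisymmetrization of a bicharacter. -/
theorem exists_antisymmetrization [Finite K]
    (hA : ∀ n : ℕ, n ≠ 0 → ∀ a : A, ∃ a', n • a' = a) {n : ℕ} (hn : n ≠ 0) (B : K → K → A)
    (hl : ∀ k k' l, B (k * k') l = B k l + B k' l) (hr : ∀ k l l', B k (l * l') = B k l + B k l')
    (alt : ∀ k, B k k = 0) (anti : ∀ k l, B k l = -B l k)
    (hdiv : ∀ k, ∃ χ : K → A, (∀ l l', χ (l * l') = χ l + χ l') ∧ ∀ l, B k l = n • χ l) :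
    ∃ s : K → K → A, (∀ k k' l, s (k * k') l = s k l + s k' l) ∧
      (∀ k l l', s k (l * l') = s k l + s k l') ∧ ∀ k l, n • (s k l - s l k) = B k l := by
  classical
  obtain ⟨ι, _, m, _, e, c, he, hc, hk⟩ := exists_coordinates K
  have hdiv' (k : K) (i : ι) : ∃ z, n • z = B k (e i) ∧ m i • z = 0 := by
    obtain ⟨χ, hχ, h⟩ := hdiv k
    refine ⟨χ (e i), (h _).symm, ?_⟩
    have h1 : χ 1 = 0 := by simpa using hχ 1 1
    have := map_prod_of_map_mul hχ {i} e m
    simpa [he, h1] using this.symm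
  -- The slice at `e i` gives a solution killed by `m j`, the slice at `e j` (up to sign) one killed
  -- by `m i`. A bicharacter needs one value killed by both.
  have hz (i j : ι) : ∃ z, n • z = B (e i) (e j) ∧ m i • z = 0 ∧ m j • z = 0 := by
    obtain ⟨z, h1, h2⟩ := hdiv' (e i) j
    obtain ⟨z', h1', h2'⟩ := hdiv' (e j) i
    exact exists_common_divisor hA hn (NeZero.ne (m i)) (NeZero.ne (m j)) (B (e i) (e j)) (-z') z
      (by rw [smul_neg, h1', anti, neg_neg]) h1 (by rw [smul_neg, h2', neg_zero]) h2
  choose z hz hzi hzj using hz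
  let lin : LinearOrder ι := linearOrderOfSTO (WellOrderingRel : ι → ι → Prop)
  -- Strictly upper triangular: antisymmetrizing then counts each pair once, and the diagonal is
  -- correct because `B` is alternating.
  let w (i j : ι) : A := if i < j then z i j else 0
  have wi (i j : ι) : m i • w i j = 0 := by simp only [w]; split_ifs <;> simp [hzi]
  have wj (i j : ι) : m j • w i j = 0 := by simp only [w]; split_ifs <;> simp [hzj]
  have hw (i j : ι) : n • (w i j - w j i) = B (e i) (e j) := by
    rcases lt_trichotomy i j with h | rfl | h
    · simp [w, h, h.not_gt, hz]
    · simp [w, alt]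
    · simp [w, h, h.not_gt, hz, ← anti]
  refine ⟨fun k l => ∑ i, ∑ j, (c i k).val • (c j l).val • w i j, ?_, ?_, fun k l => ?_⟩
  · intro k k' l
    simp only [← Finset.sum_add_distrib, hc]
    refine Finset.sum_congr rfl fun i _ => Finset.sum_congr rfl fun j _ => ?_
    exact val_add_nsmul (by rw [smul_comm, wi, smul_zero]) _ _
  · intro k l l'
    simp only [← Finset.sum_add_distrib, hc]
    refine Finset.sum_congr rfl fun i _ => Finset.sum_congr rfl fun j _ => ?_
    rw [val_add_nsmul (wj i j), smul_add]
  · have hB : B k l = ∑ i, ∑ j, (c i k).val • (c j l).val • B (e i) (e j) := by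
      conv_lhs => rw [hk k, map_prod_of_map_mul (φ := fun k => B k l) fun k k' => hl k k' l]
      refine Finset.sum_congr rfl fun i _ => ?_
      conv_lhs => rw [hk l, map_prod_of_map_mul fun l l' => hr (e i) l l', Finset.smul_sum]
    rw [hB]
    beta_reduce
    rw [Finset.sum_comm (f := fun i j => (c i l).val • (c j k).val • w i j)]
    simp only [← Finset.sum_sub_distrib, Finset.smul_sum]
    refine Finset.sum_congr rfl fun i _ => Finset.sum_congr rfl fun j _ => ?_
    rw [← hw, smul_comm (c j l).val (c i k).val, ← smul_sub, ← smul_sub, smul_comm n,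
      smul_comm n]

end Bilinear

/-- A decomposition of `G` as the product of `K` and a cyclic group of order `n` generated by `t`;
`u` is the indicator function of `K`. -/
structure Splitting (G K : Type) [CommGroup G] [CommGroup K] where
  i : K →* G
  p : G →* K
  t : G
  n : ℕ
  u : G → ℤ
  p_i : ∀ k, p (i k) = k
  p_t : p t = 1
  t_pow : t ^ n = 1
  exists_eq : ∀ g, ∃ j : ℕ, g = i (p g) * t ^ j
  u_mul : ∀ k g, u (i k * g) = u g
  sum_u : ∀ g, ∑ j ∈ Finset.range n, u (t ^ j * g) = 1

theorem exists_splitting (G : Type) [CommGroup G] [Finite G] [Nontrivial G] :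
    ∃ (K : Type) (_ : CommGroup K) (_ : Finite K), Nat.card K < Nat.card G ∧
      Nonempty (Splitting G K) := by
  classical
  obtain ⟨ι, hι, m, hm, ⟨f⟩⟩ := CommGroup.equiv_prod_multiplicative_zmod_of_finite G
  obtain ⟨r⟩ : Nonempty ι := by
    by_contra h
    rw [not_nonempty_iff] at h
    exact not_subsingleton G (f.toEquiv.subsingleton)
  have : NeZero (m r) := NeZero.of_gt (hm r)
  let q : G →* Multiplicative (ZMod (m r)) := (Pi.evalMonoidHom _ r).comp f.toMonoidHom
  let σ : Multiplicative (ZMod (m r)) →* G :=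
    f.symm.toMonoidHom.comp (MonoidHom.mulSingle (fun i => Multiplicative (ZMod (m i))) r)
  have hqσ (x) : q (σ x) = x := by simp [q, σ]
  let ω : Multiplicative (ZMod (m r)) := Multiplicative.ofAdd 1
  have hω (x : Multiplicative (ZMod (m r))) : ω ^ x.toAdd.val = x := by
    rw [← ofAdd_nsmul]; simp
  let p : G →* q.ker := MonoidHom.codRestrict
    (MonoidHom.id G * (σ.comp q)⁻¹) q.ker fun g => by simp [MonoidHom.mem_ker, hqσ]
  have hp (g : G) : (p g : G) = g * (σ (q g))⁻¹ := rfl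
  refine ⟨q.ker, inferInstance, inferInstance, ?_, ⟨⟨q.ker.subtype, p, σ ω, m r,
    fun g => if q g = 1 then 1 else 0, ?_, ?_, ?_, ?_, ?_, ?_⟩⟩⟩
  · refine Finite.card_subtype_lt (x := σ ω) ?_
    intro h
    have h1 : ω = 1 := by rw [← hqσ ω]; exact h
    have h2 : (1 : ZMod (m r)) = 0 := h1
    have : Fact (1 < m r) := ⟨hm r⟩
    exact one_ne_zero h2
  · rintro ⟨k, hk⟩
    apply Subtype.ext
    have hk : q k = 1 := hk
    simp [hp, hk]
  · apply Subtype.ext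
    simp [hp, hqσ]
  · rw [← map_pow, ← ofAdd_nsmul]
    simp
  · intro g
    refine ⟨(q g).toAdd.val, ?_⟩
    rw [← map_pow, hω]
    simp [hp]
  · rintro ⟨k, hk⟩ g
    have hk : q k = 1 := hk
    simp [hk]
  · intro g
    have e (j : ℕ) : q (σ ω ^ j * g) = ω ^ j * q g := by rw [map_mul, map_pow, hqσ]
    simp only [e]
    rw [Finset.sum_eq_single ((q g)⁻¹).toAdd.val]
    · rw [hω]; simp
    · intro j hj hne
      rw [if_neg]
      intro h
      apply hne
      have h' : ω ^ j = (q g)⁻¹ := eq_inv_of_mul_eq_one_left h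
      rw [← h', ← ofAdd_nsmul]
      simp [ZMod.val_natCast, Nat.mod_eq_of_lt (Finset.mem_range.1 hj)]
    · intro h
      exact absurd (Finset.mem_range.2 (ZMod.val_lt _)) h

/-- Induction on finite abelian groups, splitting off cyclic factors. -/
theorem splitting_induction (P : ∀ (G : Type) [CommGroup G], Prop)
    (one : ∀ (G : Type) [CommGroup G] [Subsingleton G], P G)
    (step : ∀ (G K : Type) [CommGroup G] [CommGroup K] [Finite G] [Finite K],
      Splitting G K → P K → P G)
    (G : Type) [CommGroup G] [Finite G] : P G := by
  induction h : Nat.card G using Nat.strong_induction_on generalizing G with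
  | _ c ih =>
    rcases subsingleton_or_nontrivial G with hG | hG
    · exact one G
    · obtain ⟨K, _, _, hlt, ⟨S⟩⟩ := exists_splitting G
      exact step G K S (ih _ (h ▸ hlt) K rfl)

/-! ### Norm and descent for `G = K × ⟨t⟩` -/

namespace Splitting

variable {G K A : Type} [CommGroup G] [CommGroup K] [AddCommGroup A] (S : Splitting G K)

theorem n_ne_zero : S.n ≠ 0 := by
  intro h
  have := S.sum_u 1
  simp [h] at this

/-- Averaging over the cyclic factor. -/
def norm : (List G → A) →+ (List G → A) := ∑ j ∈ Finset.range S.n, shift (S.t ^ j)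

theorem norm_apply (F : List G → A) :
    S.norm F = ∑ j ∈ Finset.range S.n, shift (S.t ^ j) F := by
  rw [norm, AddMonoidHom.finsetSum_apply]

theorem d_norm (F : List G → A) : d (S.norm F) = S.norm (d F) := by
  simp only [norm_apply, map_sum, d_shift]

theorem shift_norm (g : G) (F : List G → A) : shift g (S.norm F) = S.norm (shift g F) := by
  simp only [norm_apply, map_sum, shift_shift, mul_comm g]

theorem tau_norm (g : G) (F : List G → A) : tau g (S.norm F) = S.norm (tau g F) := by
  simp only [norm_apply, map_sum, shift_tau]

theorem norm_shift_sub (F : List G → A) : S.norm (shift S.t F - F) = 0 := by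
  have e (j : ℕ) : shift (S.t ^ j) (shift S.t F - F) =
      shift (S.t ^ (j + 1)) F - shift (S.t ^ j) F := by
    rw [map_sub, shift_shift, pow_succ]
  rw [norm_apply, Finset.sum_congr rfl fun j _ => e j,
    Finset.sum_range_sub (fun j => shift (S.t ^ j) F), S.t_pow, pow_zero, sub_self]

theorem inv_of_shift_eq {F : List G → A} (h : Inv S.i F) (ht : shift S.t F = F) : Inv id F := by
  intro g
  have hj (j : ℕ) : shift (S.t ^ j) F = F := by
    induction j with
    | zero => rw [pow_zero, shift_one]
    | succ j ih => rw [pow_succ, ← shift_shift, ht, ih]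
  obtain ⟨j, hg⟩ := S.exists_eq g
  rw [id, hg, ← shift_shift, hj, h]

theorem norm_inv {F : List G → A} (h : Inv S.i F) : Inv id (S.norm F) := by
  refine S.inv_of_shift_eq (fun k => by rw [shift_norm, h]) ?_
  rw [← sub_eq_zero, shift_norm, ← map_sub, norm_shift_sub]

theorem norm_of_inv {F : List G → A} (h : Inv id F) : S.norm F = S.n • F := by
  have e (j : ℕ) : shift (S.t ^ j) F = F := h _
  simp [norm_apply, e]

/-- Restriction to lists of vertices whose head lies in `K`. -/
def cut : (List G → A) →+ (List G → A) where
  toFun F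
    | [] => 0
    | a :: l => S.u a • F (a :: l)
  map_zero' := by
    funext l
    cases l <;> simp
  map_add' F F' := by
    funext l
    cases l <;> simp

theorem cut_inv {F : List G → A} (h : Inv S.i F) : Inv S.i (S.cut F) := fun k => by
  funext l
  cases l with
  | nil => rfl
  | cons a l =>
    have := h.apply k (a :: l)
    simp only [List.map_cons] at this
    simp [pull_apply, cut, S.u_mul, this]

/-- For each `a` exactly one translate `t ^ j * a` lies in `K`, so the head of a list selects one
summand. The empty list has no head, hence the condition on `F []`. -/
theorem sum_shift_cut {F : List G → A} (h : F [] = 0) :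
    ∑ j ∈ Finset.range S.n, shift (S.t ^ j) (S.cut (shift (S.t ^ j)⁻¹ F)) = F := by
  funext l
  rw [Finset.sum_apply]
  cases l with
  | nil => simp [pull_apply, cut, h]
  | cons a l =>
    have e (j : ℕ) : shift (S.t ^ j) (S.cut (shift (S.t ^ j)⁻¹ F)) (a :: l) =
        S.u (S.t ^ j * a) • F (a :: l) := by
      simp [pull_apply, cut, Function.comp_def]
    rw [Finset.sum_congr rfl fun j _ => e j, ← Finset.sum_smul, S.sum_u, one_smul]

theorem norm_cut {F : List G → A} (hF : Inv id F) (h : F [] = 0) : S.norm (S.cut F) = F := by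
  conv_rhs => rw [← S.sum_shift_cut h]
  have e (j : ℕ) : shift (S.t ^ j)⁻¹ F = F := hF _
  simp only [norm_apply, e]

theorem sum_shift_inv (F : List G → A) :
    ∑ j ∈ Finset.range S.n, shift (S.t ^ j)⁻¹ F = shift S.t (S.norm F) := by
  rw [norm_apply, ← Finset.sum_range_reflect, map_sum]
  refine Finset.sum_congr rfl fun j hj => ?_
  have : (S.t ^ (S.n - 1 - j))⁻¹ = S.t * S.t ^ j := by
    have hj := Finset.mem_range.1 hj
    rw [inv_eq_iff_mul_eq_one, ← pow_succ', ← pow_add, ← S.t_pow]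
    congr 1
    omega
  rw [shift_shift, this]

/-- Cochains killed by the norm are of the form `t W - W`. -/
theorem exists_shift_sub_eq {F : List G → A} (hF : Inv S.i F) (h : F [] = 0)
    (hN : S.norm F = 0) : ∃ W, Inv S.i W ∧ shift S.t W - W = F := by
  set c : ℕ → List G → A := fun j => S.cut (shift (S.t ^ j)⁻¹ F) with hc
  -- Each `t ^ j - 1` equals `t - 1` times `∑_{r < j} t ^ r`, so `tW - W = ∑ t ^ j c_j - ∑ c_j`. The
  -- first sum is `F`, the second is the cut of `t N F = 0`.
  refine ⟨∑ j ∈ Finset.range S.n, ∑ r ∈ Finset.range j, shift (S.t ^ r) (c j),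
    Inv.sum fun j _ => Inv.sum fun r _ => (S.cut_inv (hF.shift _)).shift _, ?_⟩
  have e (j : ℕ) : shift S.t (∑ r ∈ Finset.range j, shift (S.t ^ r) (c j)) -
      ∑ r ∈ Finset.range j, shift (S.t ^ r) (c j) = shift (S.t ^ j) (c j) - c j := by
    simp only [map_sum, shift_shift, ← pow_succ', ← Finset.sum_sub_distrib]
    rw [Finset.sum_range_sub (fun r => shift (S.t ^ r) (c j)), pow_zero, shift_one]
  rw [map_sum, ← Finset.sum_sub_distrib, Finset.sum_congr rfl fun j _ => e j,
    Finset.sum_sub_distrib, S.sum_shift_cut h]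
  simp only [hc]
  rw [← map_sum, S.sum_shift_inv, hN, map_zero, map_zero, sub_zero]

/-- A `K`-invariant primitive can be made `G`-invariant when its defect is the differential of a
cochain killed by the norm. -/
theorem exists_inv_primitive {α β : List G → A} (hα : Inv S.i α) (hβ : Inv S.i β)
    (hβ0 : β [] = 0) (h : shift S.t α - α = d β) (hN : S.norm β = 0) :
    ∃ γ, Inv id γ ∧ d γ = d α := by
  obtain ⟨W, hW, e⟩ := S.exists_shift_sub_eq hβ hβ0 hN
  refine ⟨α - d W, S.inv_of_shift_eq (hα.sub hW.d) ?_, by rw [map_sub, d_d, sub_zero]⟩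
  rw [← sub_eq_zero, map_sub, ← d_shift]
  have : shift S.t α - d (shift S.t W) - (α - d W) =
      (shift S.t α - α) - d (shift S.t W - W) := by
    rw [map_sub]; abel
  rw [this, e, h, sub_self]

/-- Pullback along the projection to `K`. -/
abbrev proj : (List G → A) →+ (List G → A) := pull (S.i ∘ S.p)

/-- The homotopy between the identity and the projection to `K`. -/
abbrev htpy : (List G → A) →+ (List G → A) := prism id (S.i ∘ S.p)

theorem d_htpy (F : List G → A) : d (S.htpy F) = S.proj F - F - S.htpy (d F) := by
  rw [d_prism, pull_id]

theorem htpy_inv {F : List G → A} (h : Inv S.i F) : Inv S.i (S.htpy F) := fun k => by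
  rw [htpy, shift, pull_prism id (S.i ∘ S.p) id (S.i ∘ S.p) (S.i k * ·) (S.i k * ·)
    (fun _ => rfl) (fun x => by simp [S.p_i]), h]

theorem pull_p_inv {F : List K → A} (h : Inv id F) : Inv id (pull S.p F) := fun g => by
  have e : (S.p ∘ (id g * ·)) = ((S.p g * ·) ∘ S.p) := funext fun x => by simp
  rw [shift, pull_pull, e, ← pull_pull]
  exact congrArg _ (h (S.p g))

theorem pull_i_inv {F : List G → A} (h : Inv S.i F) : Inv id (pull S.i F) := fun k => by
  have e : (S.i ∘ (id k * ·)) = ((S.i k * ·) ∘ S.i) := funext fun x => by simp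
  rw [shift, pull_pull, e, ← pull_pull]
  exact congrArg _ (h k)

theorem proj_eq (F : List G → A) : S.proj F = pull S.p (pull S.i F) := by
  rw [pull_pull]

/-- The projection `i ∘ p` commutes with translation by `K`, so the homotopy from the identity to it
preserves `K`-invariance. Through it, a primitive over `K` pulled back along `p` becomes a primitive
over `G`. -/
theorem exists_primitive {m : ℕ} {π : List G → A} {α : List K → A} (hπ : Inv id π)
    (hm : trunc (m + 1) π = π) (hd : d π = 0) (hα : Inv id α) (h : d α = pull S.i π) :
    ∃ α', Inv S.i α' ∧ trunc m α' = α' ∧ d α' = π := by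
  refine ⟨trunc m (pull S.p α - S.htpy π),
    ((S.pull_p_inv hα).comp.sub (S.htpy_inv hπ.comp)).trunc m, trunc_trunc _ _, ?_⟩
  rw [d_trunc, map_sub, d_pull, h, d_htpy, hd, map_zero, proj_eq]
  simpa using hm

end Splitting

/-! ### Symmetric 2-cocycles -/

section

variable {G K A : Type} [CommGroup G] [CommGroup K] [AddCommGroup A]

theorem cocycle_mul {φ : K →* G} {F : List G → A} (hF : Inv φ F) (hd : d F = 0) (k l : K) :
    F [1, φ (k * l)] = F [1, φ k] + F [1, φ l] := by
  have h1 := congrFun hd [1, φ k, φ (k * l)]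
  have h2 := hF.apply k [1, φ l]
  rw [d_triple] at h1
  simp only [List.map_cons, List.map_nil, mul_one, ← map_mul] at h2
  rw [h2, Pi.zero_apply, sub_add_eq_add_sub, sub_eq_zero] at h1
  rw [← h1, add_comm]

/-- Coning off with the vertex `1` contracts the augmented complex. -/
theorem exists_inv_primitive_of_subsingleton [Subsingleton G] {F : List G → A} (hd : d F = 0) :
    ∃ γ, Inv id γ ∧ d γ = F := by
  refine ⟨fun l => F (1 :: l), fun g => ?_, ?_⟩
  · rw [Subsingleton.elim (id g) 1, shift_one]
  · funext l
    have := congrFun hd (1 :: l)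
    rw [d_cons, Pi.zero_apply, sub_eq_zero] at this
    exact this.symm

/-- A symmetric `2`-cocycle on a finite abelian group with divisible coefficients is a
coboundary. -/
theorem exists_primitive_of_symmetric (hA : ∀ n : ℕ, n ≠ 0 → ∀ a : A, ∃ a', n • a' = a)
    (G : Type) [CommGroup G] [Finite G] : ∀ b : List G → A, Inv id b → trunc 3 b = b → d b = 0 →
      (∀ g h, b [1, g, g * h] = b [1, h, g * h]) → ∃ γ, Inv id γ ∧ d γ = b := by
  refine splitting_induction (fun G _ => ∀ b : List G → A, Inv id b → trunc 3 b = b → d b = 0 →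
      (∀ g h, b [1, g, g * h] = b [1, h, g * h]) → ∃ γ, Inv id γ ∧ d γ = b)
    (fun G _ _ b _ _ hd _ => exists_inv_primitive_of_subsingleton hd)
    (fun G K _ _ _ _ S ih b hb h3 hd hs => ?_) G
  obtain ⟨α₀, hα₀, e₀⟩ := ih (pull S.i b) (S.pull_i_inv hb.comp) (by rw [← pull_trunc, h3])
    (by rw [d_pull, hd, map_zero]) (fun g h => by simpa [pull_apply] using hs (S.i g) (S.i h))
  obtain ⟨α, hα, hα2, e⟩ := S.exists_primitive (m := 2) hb h3 hd hα₀ e₀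
  -- At `[1, y]` this is the commutator pairing of `t` and `y`; invariance reduces all pairs to that
  -- case. No correction term is therefore needed in `β`.
  have hτ : tau S.t b = 0 := by
    funext l
    by_cases hl : l.length = 2
    · obtain ⟨x, y, rfl⟩ := List.length_eq_two.1 hl
      rw [← (hb.tau S.t).apply x⁻¹]
      simp only [id, List.map_cons, List.map_nil, inv_mul_cancel]
      rw [prism_pair]
      simp only [id, mul_one]
      exact sub_eq_zero.2 (hs _ _)
    · rw [tau, prism_congr (F' := 0) _ _ l fun l' hl' => ?_, map_zero]
      rw [← h3, trunc_of_length_ne _ (by omega)]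
      rfl
  set β := trunc 1 (tau S.t α) with hβ
  have hβi : Inv S.i β := (hα.tau _).trunc _
  have eβ : d β = shift S.t α - α := by
    rw [hβ, d_trunc, d_tau, e, hτ, sub_zero]
    conv_rhs => rw [← hα2, shift, pull_trunc]
    funext l
    simp only [trunc, Pi.sub_apply]
    split_ifs <;> simp
  have hconst (x : G) : S.norm β [x] = S.norm β [1] := by
    have : d (S.norm β) [1, x] = 0 := by rw [S.d_norm, eβ, S.norm_shift_sub]; rfl
    rwa [d_pair, sub_eq_zero] at this
  -- The norm of `β` is a constant; divisibility provides a constant cochain with the same norm, and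
  -- subtracting it kills the norm.
  obtain ⟨a, ha⟩ := hA S.n S.n_ne_zero (S.norm β [1])
  set κ : List G → A := trunc 1 fun _ => a with hκ
  have hκi : Inv id κ := Inv.trunc (fun _ => rfl) 1
  have hκd : d κ = 0 := by
    rw [hκ, d_trunc]
    funext l
    by_cases hl : l.length = 2
    · obtain ⟨x, y, rfl⟩ := List.length_eq_two.1 hl
      rw [trunc_of_length _ hl, d_pair, sub_self]
      rfl
    · exact trunc_of_length_ne _ hl
  rw [← e]
  refine S.exists_inv_primitive (β := β - κ) hα (hβi.sub hκi.comp) (by simp [hβ, hκ, trunc])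
    (by rw [map_sub, hκd, sub_zero, eβ]) ?_
  rw [map_sub, S.norm_of_inv hκi, sub_eq_zero]
  funext l
  by_cases hl : l.length = 1
  · obtain ⟨x, rfl⟩ := List.length_eq_one_iff.1 hl
    rw [hconst, ← ha, Pi.smul_apply, hκ, trunc_of_length _ hl]
  · rw [S.norm_apply, Finset.sum_apply, Pi.smul_apply, hκ, trunc_of_length_ne _ hl, smul_zero]
    exact Finset.sum_eq_zero fun j _ => trunc_of_length_ne _ (by simpa using hl)

end

/-! ### Commutator pairings and norms of cocycles -/

section

variable {G K A : Type} [CommGroup G] [CommGroup K] [AddCommGroup A]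

theorem Inv.apply_singleton {F : List G → A} (hF : Inv id F) (x : G) : F [x] = F [1] := by
  have := hF.apply x [1]
  simpa using this

theorem trunc_shift_sub {m : ℕ} {F : List G → A} (h : trunc m F = F) (g : G) :
    trunc m (shift g F - F) = shift g F - F := by
  conv_rhs => rw [← h, shift, pull_trunc]
  funext l
  simp only [trunc, Pi.sub_apply]
  split_ifs <;> simp

/-- The homogeneous `2`-cocycle attached to a bicharacter. -/
def bicharCocycle (s : K → K → A) : List K → A
  | [x, y, z] => s (x⁻¹ * y) (y⁻¹ * z)
  | _ => 0

theorem trunc_bicharCocycle (s : K → K → A) : trunc 3 (bicharCocycle s) = bicharCocycle s := by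
  funext l
  rcases l with _ | ⟨x, _ | ⟨y, _ | ⟨z, _ | ⟨w, l⟩⟩⟩⟩ <;> simp [trunc, bicharCocycle]

theorem bicharCocycle_inv (s : K → K → A) : Inv id (bicharCocycle s) := fun k => by
  funext l
  rcases l with _ | ⟨x, _ | ⟨y, _ | ⟨z, _ | ⟨w, l⟩⟩⟩⟩ <;> simp [pull_apply, bicharCocycle]

theorem d_bicharCocycle {s : K → K → A} (hl : ∀ k k' l, s (k * k') l = s k l + s k' l)
    (hr : ∀ k l l', s k (l * l') = s k l + s k l') : d (bicharCocycle s) = 0 := by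
  rw [← trunc_bicharCocycle, d_trunc]
  funext l
  by_cases h : l.length = 4
  · rw [trunc_of_length _ h]
    obtain ⟨x, y, z, w, rfl⟩ : ∃ x y z w, l = [x, y, z, w] := by
      rcases l with _ | ⟨x, _ | ⟨y, _ | ⟨z, _ | ⟨w, _ | ⟨v, l⟩⟩⟩⟩⟩ <;> simp at h
      exact ⟨x, y, z, w, rfl⟩
    have e (x y z : K) : x⁻¹ * z = (x⁻¹ * y) * (y⁻¹ * z) := by group
    rw [d_quadruple]
    simp only [bicharCocycle]
    have h1 : s (x⁻¹ * z) (z⁻¹ * w) = s (x⁻¹ * y) (z⁻¹ * w) + s (y⁻¹ * z) (z⁻¹ * w) := by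
      rw [e x y z, hl]
    have h2 : s (x⁻¹ * y) (y⁻¹ * w) = s (x⁻¹ * y) (y⁻¹ * z) + s (x⁻¹ * y) (z⁻¹ * w) := by
      rw [e y z w, hr]
    rw [h1, h2, Pi.zero_apply]
    abel
  · exact trunc_of_length_ne _ h

namespace Splitting

variable (S : Splitting G K)

theorem norm_trunc (m : ℕ) (F : List G → A) : S.norm (trunc m F) = trunc m (S.norm F) := by
  simp only [norm_apply, shift, pull_trunc]
  funext l
  by_cases h : l.length = m <;> simp [trunc, h]

theorem norm_proj (F : List G → A) : S.norm (S.proj F) = S.n • S.proj F := by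
  have e (j : ℕ) : shift (S.t ^ j) (S.proj F) = S.proj F := by
    have : (S.i ∘ S.p) ∘ (S.t ^ j * ·) = S.i ∘ S.p := funext fun x => by simp [S.p_t]
    rw [shift, pull_pull, this]
  simp only [norm_apply, e, Finset.sum_const, Finset.card_range]

/-- As `p t = 1`, the value is `F [k, k, l] - F [k, l, l]`. The cocycle condition reduces both
degenerate terms to `F [1, 1, 1]`. -/
theorem tau_proj_pair {F : List G → A} (hF : Inv S.i F) (hd : d F = 0) (x y : G) :
    tau S.t (S.proj F) [x, y] = 0 := by
  rw [prism_pair]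
  simp only [pull_apply, List.map_cons, List.map_nil, Function.comp_apply, id, map_mul, S.p_t,
    one_mul]
  set k := S.p x
  set l := S.p y
  have h1 := congrFun hd [S.i k, S.i k, S.i k, S.i l]
  have h2 := congrFun hd [S.i k, S.i l, S.i l, S.i l]
  have h3 (k : K) := hF.apply k [1, 1, 1]
  rw [d_quadruple] at h1 h2
  simp only [List.map_cons, List.map_nil, mul_one, Pi.zero_apply] at h1 h2 h3
  rw [h3] at h1 h2
  rw [sub_self, zero_add, sub_eq_zero] at h1
  rw [sub_add_cancel, sub_eq_zero] at h2
  rw [h1, ← h2, sub_self]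

/-- Up to a coboundary `F` is its projection, where `tau_proj_pair` applies. The coboundary
contributes the differential of a `G`-invariant 0-cochain, which vanishes on pairs since such a
cochain is constant. -/
theorem norm_tau_pair {F : List G → A} (hF : Inv S.i F) (hd : d F = 0) (h : G) :
    S.norm (tau S.t F) [1, h] = 0 := by
  have e : F = S.proj F - d (S.htpy F) := by rw [d_htpy, hd, map_zero]; abel
  have e' : S.norm (tau S.t F) =
      S.norm (tau S.t (S.proj F)) + d (S.norm (tau S.t (S.htpy F))) := by
    conv_lhs => rw [e]
    rw [map_sub, tau_d, map_sub, map_sub, S.norm_shift_sub, d_norm]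
    abel
  have hi : Inv id (S.norm (tau S.t (S.htpy F))) := S.norm_inv ((S.htpy_inv hF).tau _)
  rw [e', Pi.add_apply, d_pair, hi.apply_singleton h, sub_self, add_zero, norm_apply,
    Finset.sum_apply]
  exact Finset.sum_eq_zero fun j _ => S.tau_proj_pair hF hd _ _

/-- The same comparison with the projection, which is fixed by `t`, so that its norm is
multiplication by `n`. -/
theorem norm_pair {F : List G → A} (hF : Inv S.i F) (hd : d F = 0) (h : G) :
    S.norm F [1, h] = S.n • F [1, S.i (S.p h)] := by
  have e : F = S.proj F - d (S.htpy F) := by rw [d_htpy, hd, map_zero]; abel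
  have e' : S.norm F = S.n • S.proj F - d (S.norm (S.htpy F)) := by
    conv_lhs => rw [e]
    rw [map_sub, S.norm_proj, d_norm]
  have hi : Inv id (S.norm (S.htpy F)) := S.norm_inv (S.htpy_inv hF)
  rw [e', Pi.sub_apply, d_pair, hi.apply_singleton h, sub_self, sub_zero, Pi.smul_apply]
  simp [pull_apply]

/-- A bicharacter on `G` which is antisymmetric and vanishes on the cyclic factor is pulled back
from `K`. -/
theorem bichar_eq {B : G → G → A} (hl : ∀ k k' l, B (k * k') l = B k l + B k' l)
    (hr : ∀ k l l', B k (l * l') = B k l + B k l') (anti : ∀ k l, B k l = -B l k)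
    (htt : B S.t S.t = 0) (hkt : ∀ k, B (S.i k) S.t = 0) (g h : G) :
    B g h = B (S.i (S.p g)) (S.i (S.p h)) := by
  have pow (x : G) (hx : B x S.t = 0) (j : ℕ) : B x (S.t ^ j) = 0 := by
    induction j with
    | zero => simpa using hr x 1 1
    | succ j ih => rw [pow_succ, hr, ih, hx, add_zero]
  have hgt (g : G) : B g S.t = 0 := by
    obtain ⟨j, hj⟩ := S.exists_eq g
    rw [hj, hl, hkt, anti, pow _ htt, neg_zero, add_zero]
  obtain ⟨j, hj⟩ := S.exists_eq g
  obtain ⟨r, hr'⟩ := S.exists_eq h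
  conv_lhs => rw [hr', hr, pow _ (hgt g), add_zero, hj, hl, anti (S.t ^ j), pow _ (hgt _),
    neg_zero, add_zero]

end Splitting

/-- The commutator pairing of a `2`-cocycle. -/
def commutatorPairing (b : List G → A) (g h : G) : A := b [1, g, g * h] - b [1, h, g * h]

theorem commutatorPairing_eq_tau (b : List G → A) (g h : G) :
    commutatorPairing b g h = tau g b [1, h] := by
  rw [prism_pair]
  simp [commutatorPairing]

theorem commutatorPairing_neg (b : List G → A) (g h : G) :
    commutatorPairing b g h = -commutatorPairing b h g := by
  simp [commutatorPairing, mul_comm]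

theorem commutatorPairing_mul_right {b : List G → A} (hb : Inv id b) (hd : d b = 0) (g h h' : G) :
    commutatorPairing b g (h * h') = commutatorPairing b g h + commutatorPairing b g h' := by
  simp only [commutatorPairing_eq_tau]
  exact cocycle_mul (φ := MonoidHom.id G) (hb.tau g)
    (by rw [d_tau, hd, map_zero, sub_zero, sub_eq_zero]; exact hb g) h h'

theorem commutatorPairing_mul_left {b : List G → A} (hb : Inv id b) (hd : d b = 0) (g g' h : G) :
    commutatorPairing b (g * g') h = commutatorPairing b g h + commutatorPairing b g' h := by
  rw [commutatorPairing_neg, commutatorPairing_mul_right hb hd, neg_add, ← commutatorPairing_neg,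
    ← commutatorPairing_neg]

/-- Slices of the commutator pairing of the norm of `β` are divisible by `n`. -/
theorem exists_character (S : Splitting G K) {α β ρ : List G → A} (hα : Inv S.i α)
    (hβ : Inv S.i β) (hρ : Inv id ρ) (h : shift S.t α - α = d β) (k : K)
    (hk : d ρ = tau (S.i k) (d α)) :
    ∃ χ : K → A, (∀ l l', χ (l * l') = χ l + χ l') ∧
      ∀ g, commutatorPairing (S.norm β) (S.i k) g = S.n • χ (S.p g) := by
  -- `k` fixes `α`, so `d τ_k α = -τ_k dα`, which `ρ` cancels.
  set ζ := tau (S.i k) α + ρ with hζ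
  have hζi : Inv S.i ζ := (hα.tau _).add hρ.comp
  have hζd : d ζ = 0 := by
    rw [hζ, map_add, d_tau, hk, hα k]
    abel
  have ht : shift S.t ρ = ρ := hρ S.t
  have hζt : shift S.t ζ - ζ = tau (S.i k) (d β) := by
    rw [hζ, map_add, ht, shift_tau, ← h, map_sub]
    abel
  -- Both summands have differential `± τ_k dβ`. The norm does not see `τ_t ζ` on pairs `[1, g]`, so
  -- there `N θ` is `τ_k (N β)`, the pairing to be computed.
  set θ := tau S.t ζ + tau (S.i k) β with hθ
  have hθi : Inv S.i θ := (hζi.tau _).add (hβ.tau _)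
  have hθd : d θ = 0 := by
    rw [hθ, map_add, d_tau, d_tau, hζd, hβ k, hζt, map_zero]
    abel
  refine ⟨fun l => θ [1, S.i l], cocycle_mul hθi hθd, fun g => ?_⟩
  rw [← S.norm_pair hθi hθd, commutatorPairing_eq_tau, S.tau_norm, hθ, map_add, Pi.add_apply,
    S.norm_tau_pair hζi hζd, zero_add]

end

/-- A `4`-cocycle on a finite abelian group with divisible coefficients all of whose transgressions
are coboundaries is a coboundary. -/
theorem exists_primitive_of_tau {A : Type} [AddCommGroup A]
    (hA : ∀ n : ℕ, n ≠ 0 → ∀ a : A, ∃ a', n • a' = a)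
    (G : Type) [CommGroup G] [Finite G] : ∀ π : List G → A, Inv id π → trunc 5 π = π → d π = 0 →
      (∀ g, ∃ ρ, Inv id ρ ∧ d ρ = tau g π) → ∃ γ, Inv id γ ∧ d γ = π := by
  refine splitting_induction (fun G _ => ∀ π : List G → A, Inv id π → trunc 5 π = π → d π = 0 →
      (∀ g, ∃ ρ, Inv id ρ ∧ d ρ = tau g π) → ∃ γ, Inv id γ ∧ d γ = π)
    (fun G _ _ π _ _ hd _ => exists_inv_primitive_of_subsingleton hd)
    (fun G K _ _ _ _ S ih π hπ h5 hd hτ => ?_) G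
  choose ρ hρ eρ using hτ
  obtain ⟨α₀, hα₀, e₀⟩ := ih (pull S.i π) (S.pull_i_inv hπ.comp) (by rw [← pull_trunc, h5])
    (by rw [d_pull, hd, map_zero]) fun k => ⟨pull S.i (ρ (S.i k)), S.pull_i_inv (hρ _).comp, by
      rw [d_pull, eρ]
      exact pull_prism id (S.i k * ·) id (k * ·) S.i S.i (fun _ => rfl)
        (fun _ => (map_mul S.i _ _).symm) π⟩
  obtain ⟨α, hα, hα4, e⟩ := S.exists_primitive (m := 4) hπ h5 hd hα₀ e₀
  set β := trunc 3 (tau S.t α + ρ S.t) with hβ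
  have hβi : Inv S.i β := ((hα.tau _).add (hρ _).comp).trunc _
  have eβ : shift S.t α - α = d β := by
    rw [hβ, d_trunc, map_add, d_tau, e, eρ, sub_add_cancel, trunc_shift_sub hα4]
  set b := S.norm β with hb
  have hbi : Inv id b := S.norm_inv hβi
  have hbd : d b = 0 := by rw [hb, S.d_norm, ← eβ, S.norm_shift_sub]
  have hb3 : trunc 3 b = b := by rw [hb, hβ, S.norm_trunc, trunc_trunc]
  have hchar (k : K) := exists_character S hα hβi (hρ (S.i k)) eβ k (by rw [e, eρ])
  have alt (g : G) : commutatorPairing b g g = 0 := sub_self _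
  obtain ⟨s, sl, sr, hs⟩ := exists_antisymmetrization hA S.n_ne_zero
    (fun k l => commutatorPairing b (S.i k) (S.i l))
    (fun k k' l => by rw [map_mul, commutatorPairing_mul_left hbi hbd])
    (fun k l l' => by rw [map_mul, commutatorPairing_mul_right hbi hbd])
    (fun k => alt _) (fun k l => commutatorPairing_neg _ _ _)
    (fun k => by
      obtain ⟨χ, hχ, h⟩ := hchar k
      exact ⟨χ, hχ, fun l => by rw [h, S.p_i]⟩)
  have hpair (g h : G) :
      commutatorPairing b g h = S.n • (s (S.p g) (S.p h) - s (S.p h) (S.p g)) := by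
    rw [hs]
    -- The pairing at `(k, t)` is `n` times a character of `K` at `p t = 1`, hence zero.
    refine S.bichar_eq (commutatorPairing_mul_left hbi hbd) (commutatorPairing_mul_right hbi hbd)
      (commutatorPairing_neg b) (alt _) (fun k => ?_) g h
    obtain ⟨χ, hχ, h⟩ := hchar k
    have h1 : χ 1 = 0 := by simpa using hχ 1 1
    rw [h, S.p_t, h1, smul_zero]
  set σ := pull S.p (bicharCocycle s) with hσ
  have hσi : Inv id σ := S.pull_p_inv (bicharCocycle_inv s)
  have hσd : d σ = 0 := by rw [hσ, d_pull, d_bicharCocycle sl sr, map_zero]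
  have hσ3 : trunc 3 σ = σ := by rw [hσ, ← pull_trunc, trunc_bicharCocycle]
  have h3 : trunc 3 (b - S.n • σ) = b - S.n • σ := by
    conv_rhs => rw [← hb3, ← hσ3]
    funext l
    by_cases h : l.length = 3 <;> simp [trunc, h]
  obtain ⟨γ, hγ, eγ⟩ := exists_primitive_of_symmetric hA G (b - S.n • σ)
    (hbi.sub (hσi.nsmul _)) h3 (by rw [map_sub, map_nsmul, hbd, hσd, smul_zero, sub_zero])
    (fun g h => by
      have h1 : σ [1, g, g * h] = s (S.p g) (S.p h) := by
        simp [hσ, pull_apply, bicharCocycle]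
      have h2 : σ [1, h, g * h] = s (S.p h) (S.p g) := by
        simp [hσ, pull_apply, bicharCocycle, mul_comm (S.p g)]
      have := hpair g h
      rw [commutatorPairing, smul_sub, sub_eq_sub_iff_sub_eq_sub] at this
      simpa [h1, h2] using this)
  have hγ2 : d (trunc 2 γ) = b - S.n • σ := by rw [d_trunc, eγ, h3]
  rw [← e]
  -- `N` sends the three terms to `b`, `nσ` and `dγ` respectively, the last because `N (cut γ) = γ`
  -- for the degree part `trunc 2 γ`.
  refine S.exists_inv_primitive (β := β - σ - d (S.cut (trunc 2 γ))) hα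
    ((hβi.sub hσi.comp).sub (S.cut_inv (hγ.trunc 2).comp).d)
    (by simp [hβ, trunc, hσ, pull_apply, bicharCocycle])
    (by rw [map_sub, map_sub, hσd, d_d, sub_zero, sub_zero, eβ]) ?_
  rw [map_sub, map_sub, ← S.d_norm, S.norm_cut (hγ.trunc 2) (by simp [trunc]), hγ2,
    S.norm_of_inv hσi, sub_self]

end ListCochain

/-! ### Return to cohomology with coefficients in `ℚ/ℤ` -/

theorem mainTheorem9 {G : Type} [CommGroup G] [Finite G]
    (c : groupCohomology (Rep.trivial ℤ G (AddCircle (1 : ℚ))) 4) :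
    (∀ g : G, transgression (AddCircle (1 : ℚ)) g 3 c = 0) ↔ c = 0 := by
  refine ⟨fun h => ?_, fun h g => by rw [h, map_zero]⟩
  induction c using groupCohomology_induction_on with
  | h z =>
  set f : (Fin 4 → G) → AddCircle (1 : ℚ) :=
    groupCohomology.iCocycles (Rep.trivial ℤ G (AddCircle (1 : ℚ))) 4 z with hf
  have hdf : Transgression.diff G (AddCircle (1 : ℚ)) 4 f = 0 := by
    have := HomologicalComplex.iCycles_d
      (groupCohomology.inhomogeneousCochains (Rep.trivial ℤ G (AddCircle (1 : ℚ)))) 4 5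
    rw [groupCohomology.inhomogeneousCochains.d_def] at this
    exact congr($(this).hom z)
  have hτ (g : G) : ∃ a, Transgression.diff G (AddCircle (1 : ℚ)) 2 a =
      Transgression.cochainMap (AddCircle (1 : ℚ)) g 3 f := by
    have h1 : transgression (AddCircle (1 : ℚ)) g 3 (groupCohomology.π _ 4 z) =
        groupCohomology.π _ 3 (Transgression.cocyclesHom _ g 3 z) :=
      congr($(π_transgression (AddCircle (1 : ℚ)) g 3).hom z)
    have h2 := h g
    rw [h1, ListCochain.π_eq_zero_iff, ListCochain.iCocycles_cocyclesHom] at h2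
    exact h2
  have hA (n : ℕ) (hn : n ≠ 0) (a : AddCircle (1 : ℚ)) : ∃ a', n • a' = a := by
    obtain ⟨x, rfl⟩ := QuotientAddGroup.mk_surjective a
    refine ⟨((x / n : ℚ) : AddCircle (1 : ℚ)), ?_⟩
    rw [← AddCircle.coe_nsmul, nsmul_eq_mul, mul_div_cancel₀ _ (Nat.cast_ne_zero.2 hn)]
  obtain ⟨γ, hγ, e⟩ := ListCochain.exists_primitive_of_tau hA G
    (ListCochain.homog (ListCochain.ofFin 4 f)) (ListCochain.homog_inv _)
    (by rw [ListCochain.trunc_homog, ListCochain.trunc_ofFin])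
    (by
      rw [ListCochain.d_homog, ← ListCochain.ofFin_diff, hdf]
      have : ListCochain.ofFin 5 (0 : (Fin 5 → G) → AddCircle (1 : ℚ)) = 0 :=
        ListCochain.ofFin_eq_trunc 5 0 |>.trans (by funext l; simp [ListCochain.trunc])
      rw [this, ListCochain.homog_zero])
    (fun g => by
      obtain ⟨a, ha⟩ := hτ g
      refine ⟨ListCochain.homog (ListCochain.ofFin 2 a), ListCochain.homog_inv _, ?_⟩
      rw [ListCochain.d_homog, ← ListCochain.ofFin_diff, ha, ListCochain.ofFin_cochainMap,
        ListCochain.tau_homog])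
  rw [ListCochain.π_eq_zero_iff]
  exact ListCochain.exists_diff_eq 3 f γ hγ e
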